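/- Let $n\in\mathbb N$, $1\le q<\infty$ and $s>1$. Write $\langle x\rangle=(1+|x|^2)^{1/2}$ for $x\in\mathbb R^n$. Fix a window $g\in\mathcal S(\mathbb R^n)\setminus\{0\}$. For $f\in\mathcal S'(\mathbb R^n)$ let \[ V_g f(x,\xi)=(2\pi)^{-n/2}\,\big\langle f,\ \overline{g(\cdot-x)}\,e^{-i(\cdot)\cdot\xi}\big\rangle \] be its short-time Fourier transform, where $\langle f,\psi\rangle$ denotes the (bilinear) pairing of $f\in\mathcal S'(\mathbb R^n)$ with $\psi\in\mathcal S(\mathbb R^n)$, and let $\mathring M^{\infty,q}_s(\mathbb R^n)$ be the set of all $f\in\mathcal S'(\mathbb R^n)$ with \[ \|f\|_{\mathring M^{\infty,q}_s}=\Big(\int_{\mathbb R^n}\big(\operatorname*{ess\,sup}_{x\in\mathbb R^n}|V_g f(x,\xi)|\,\langle\xi\rangle^{s}\big)^q\,d\xi\Big)^{1/q}<\infty . \] Let $\ell^q_s(\mathbb Z^n)$ be the set of all families $(c_\alpha)_{\alpha\in\mathbb Z^n}$ of complex numbers with $\sum_{\alpha}\langle\alpha\rangle^{sq}|c_\alpha|^q<\infty$.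 Let $\phi\in\mathcal S(\mathbb R^n)$ satisfy $\sum_{\alpha\in\mathbb Z^n}\phi(x-2\pi\alpha)=1$ for all $x\in\mathbb R^n$. If $f\in\mathcal S'(\mathbb R^n)$ is $2\pi$-periodic in each variable, then \[ f=\sum_{\alpha\in\mathbb Z^n}c_\alpha e^{ix\cdot\alpha}\quad\text{with (unconditional) weak convergence in }\mathcal S'(\mathbb R^n),\qquad c_\alpha=(2\pi)^{-n}\big\langle f,\ \phi\,e^{-i(\cdot)\cdot\alpha}\big\rangle . \] Moreover, $f\in\mathring M^{\infty,q}_s(\mathbb R^n)$ if and only if $(c_\alpha)_{\alpha\in\mathbb Z^n}\in\ell^q_s(\mathbb Z^n)$. -/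

import Mathlib

open MeasureTheory Complex
open scoped SchwartzMap ENNReal Real

noncomputable section

namespace PeriodicModulation

/-- Euclidean space `ℝⁿ`. -/
abbrev Rn (n : ℕ) : Type := EuclideanSpace ℝ (Fin n)

/-- The lattice point `α ∈ ℤⁿ`, seen as a vector of `ℝⁿ`. -/
def latticePoint {n : ℕ} (α : Fin n → ℤ) : Rn n :=
  WithLp.toLp 2 (fun j => (α j : ℝ))

/-- The plane wave `x ↦ e^{i x·ξ}`. -/
def planeWave {n : ℕ} (ξ : Rn n) (x : Rn n) : ℂ :=
  Complex.exp (((inner ℝ ξ x : ℝ) : ℂ) * Complex.I)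

theorem iteratedDeriv_exp_mul_I (k : ℕ) :
    iteratedDeriv k (fun t : ℝ => Complex.exp ((t : ℂ) * Complex.I)) =
      fun t : ℝ => Complex.I ^ k * Complex.exp ((t : ℂ) * Complex.I) := by
  induction k with
  | zero => simp
  | succ k ih =>
    rw [iteratedDeriv_succ, ih]
    funext t
    have h : HasDerivAt (fun t : ℝ => Complex.exp ((t : ℂ) * Complex.I))
        (Complex.exp ((t : ℂ) * Complex.I) * (1 * Complex.I)) t :=
      ((Complex.ofRealCLM.hasDerivAt (x := t)).mul_const Complex.I).cexp
    rw [(h.const_mul (Complex.I ^ k)).deriv]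
    ring

theorem hasTemperateGrowth_exp_mul_I :
    (fun t : ℝ => Complex.exp ((t : ℂ) * Complex.I)).HasTemperateGrowth := by
  refine ⟨(Complex.ofRealCLM.contDiff.mul contDiff_const).cexp, fun k => ⟨0, 1, fun t => ?_⟩⟩
  rw [norm_iteratedFDeriv_eq_norm_iteratedDeriv, iteratedDeriv_exp_mul_I]
  simp [Complex.norm_exp_ofReal_mul_I]

theorem hasTemperateGrowth_planeWave {n : ℕ} (ξ : Rn n) :
    (planeWave ξ).HasTemperateGrowth :=
  hasTemperateGrowth_exp_mul_I.comp (Function.hasTemperateGrowth_inner_right ξ)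

/-- The tempered distribution given by the function `x ↦ e^{i x·α}`, for `α ∈ ℤⁿ`. -/
def character {n : ℕ} (α : Fin n → ℤ) : 𝓢'(Rn n, ℂ) :=
  (hasTemperateGrowth_planeWave (latticePoint α)).toTemperedDistribution volume

theorem character_apply {n : ℕ} (α : Fin n → ℤ) (ψ : 𝓢(Rn n, ℂ)) :
    character α ψ = ∫ x, ψ x * Complex.exp (((inner ℝ (latticePoint α) x : ℝ) : ℂ) * Complex.I) :=
  rfl

/-- The Schwartz function `y ↦ ψ(y) e^{-i y·ξ}`. -/
def demodulate {n : ℕ} (ξ : Rn n) (ψ : 𝓢(Rn n, ℂ)) : 𝓢(Rn n, ℂ) :=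
  SchwartzMap.smulLeftCLM ℂ (planeWave (-ξ)) ψ

theorem demodulate_apply {n : ℕ} (ξ : Rn n) (ψ : 𝓢(Rn n, ℂ)) (y : Rn n) :
    demodulate ξ ψ y = ψ y * Complex.exp (-(((inner ℝ ξ y : ℝ) : ℂ) * Complex.I)) := by
  rw [demodulate, SchwartzMap.smulLeftCLM_apply_apply (hasTemperateGrowth_planeWave (-ξ))]
  simp [planeWave, mul_comm]

/-- The Schwartz function `y ↦ conj (g (y - x)) e^{-i y·ξ}`, i.e. the complex conjugate of
`M_ξ T_x g`. -/
def conjTimeFreqShift {n : ℕ} (g : 𝓢(Rn n, ℂ)) (x ξ : Rn n) : 𝓢(Rn n, ℂ) :=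
  demodulate ξ
    (SchwartzMap.postcompCLM (𝕜 := ℝ) (Complex.conjCLE : ℂ →L[ℝ] ℂ)
      (SchwartzMap.compSubConstCLM ℂ x g))

theorem conjTimeFreqShift_apply {n : ℕ} (g : 𝓢(Rn n, ℂ)) (x ξ y : Rn n) :
    conjTimeFreqShift g x ξ y =
      (starRingEnd ℂ) (g (y - x)) * Complex.exp (-(((inner ℝ ξ y : ℝ) : ℂ) * Complex.I)) := by
  simp [conjTimeFreqShift, demodulate_apply]

/-- The short-time Fourier transform of a tempered distribution `f` with window `g`,
`V_g f(x, ξ) = (2π)^{-n/2} ∫ f(y) conj (g (y - x)) e^{-i y·ξ} dy`, the integral being the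
distributional pairing. -/
def stft {n : ℕ} (g : 𝓢(Rn n, ℂ)) (f : 𝓢'(Rn n, ℂ)) (x ξ : Rn n) : ℂ :=
  (((2 * π) ^ (-(n : ℝ) / 2) : ℝ) : ℂ) * f (conjTimeFreqShift g x ξ)

/-- The weight `⟨x⟩^s = (1 + |x|²)^{s/2}`. -/
def weight {n : ℕ} (s : ℝ) (x : Rn n) : ℝ :=
  (1 + ‖x‖ ^ 2) ^ (s / 2)

/-- The norm of the weighted modulation space `M̊^{p,q}_{s,σ}(ℝⁿ)` with respect to the window `g`:
the `L^q` norm in `ξ` of the `L^p` norm in `x` of `V_g f(x, ξ) ⟨x⟩^σ ⟨ξ⟩^s`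
(essential suprema when an exponent is `∞`), with values in `[0, ∞]`. -/
def modulationNorm {n : ℕ} (g : 𝓢(Rn n, ℂ)) (p q : ℝ≥0∞) (s σ : ℝ) (f : 𝓢'(Rn n, ℂ)) : ℝ≥0∞ :=
  eLpNorm
    (fun ξ : Rn n =>
      eLpNorm (fun x : Rn n => stft g f x ξ * ((weight σ x * weight s ξ : ℝ) : ℂ)) p volume)
    q volume

/-- The weighted modulation space `M̊^{p,q}_{s,σ}(ℝⁿ)`, defined with the window `g`. -/
def modulationSpace {n : ℕ} (g : 𝓢(Rn n, ℂ)) (p q : ℝ≥0∞) (s σ : ℝ) : Set (𝓢'(Rn n, ℂ)) :=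
  {f | modulationNorm g p q s σ f < ∞}

/-- The weighted sequence space `ℓ^q_s(ℤⁿ)`: all `c` such that `(⟨α⟩^s c_α)_α` lies in `ℓ^q`. -/
def weightedSequenceSpace (n : ℕ) (q : ℝ≥0∞) (s : ℝ) : Set ((Fin n → ℤ) → ℂ) :=
  {c | Memℓp (fun α => ((weight s (latticePoint α) : ℝ) : ℂ) * c α) q}

/-- The distribution `f` has period `2π` in each variable: it is invariant under the translations
by `2π e_j` (equivalently, pairing with `f` is invariant under these translations of the test
function). -/
def IsPeriodic {n : ℕ} (f : 𝓢'(Rn n, ℂ)) : Prop :=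
  ∀ (j : Fin n) (ψ : 𝓢(Rn n, ℂ)),
    f (SchwartzMap.compSubConstCLM ℂ (EuclideanSpace.single j (2 * π)) ψ) = f ψ

/-- The translates of `φ` by the period lattice `2πℤⁿ` sum to one. -/
def IsPeriodicPartition {n : ℕ} (φ : 𝓢(Rn n, ℂ)) : Prop :=
  ∀ x : Rn n, HasSum (fun α : Fin n → ℤ => φ (x - (2 * π) • latticePoint α)) 1

/-- The Fourier coefficient `c_α = (2π)^{-n} ∫ f(x) φ(x) e^{-i x·α} dx` of a periodic
distribution `f`, the integral being the distributional pairing. -/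
def fourierCoefficient {n : ℕ} (φ : 𝓢(Rn n, ℂ)) (f : 𝓢'(Rn n, ℂ)) (α : Fin n → ℤ) : ℂ :=
  ((((2 * π) ^ n)⁻¹ : ℝ) : ℂ) * f (demodulate (latticePoint α) φ)

end PeriodicModulation

end

/-! Everything rests on Poisson summation: for Schwartz `ψ`, the lattice sum `∑ ψ(x - 2πβ)` equals
`(2π)^{-n} ∑ ⟨e^{iα·}, ψ⟩ e^{-iα·x}` (`hasSum_character_mul_exp`). Multiplied by `φ`, both sides
converge in the Schwartz space, so `f` may be applied termwise. Periodicity and the partition of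
unity turn one side into `f ψ` (`IsPeriodic.hasSum_localized`); the other is the Fourier series of
`f` tested on `ψ`.

Taking `ψ` to be a conjugated time-frequency shift of `g` gives `V_g f(x, ξ) = (2π)^{-n/2} ∑ c_α K(ξ
- α) e^{-i(ξ-α)·x}` with `K = windowTransform g` (`IsPeriodic.hasSum_stft`). For fixed `ξ` this is,
up to a unimodular factor, an absolutely convergent trigonometric series in `x`. Its supremum
dominates every single coefficient up to a constant; since `K` is bounded below on some ball,
integrating over disjoint balls around the shifted lattice points yields the `ℓ^q` bound. Conversely
the supremum is at most the sum of the moduli, a convolution of the weighted coefficients with a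
rapidly decaying kernel, and a Young-type inequality gives the modulation norm bound. -/

namespace PeriodicModulation

open scoped FourierTransform

/-! ### Convergent series in the Schwartz space and seminorm bounds for translates. -/

section Schwartz

variable {E : Type*} [NormedAddCommGroup E] [NormedSpace ℝ E]
  {F : Type*} [NormedAddCommGroup F] [NormedSpace ℝ F]

theorem exists_one_add_norm_pow_mul_iteratedFDeriv_le (u : 𝓢(E, F)) (k l : ℕ) :
    ∃ C : ℝ, 0 ≤ C ∧ ∀ x, (1 + ‖x‖) ^ k * ‖iteratedFDeriv ℝ l u x‖ ≤ C :=
  ⟨_, by positivity, fun x => SchwartzMap.one_add_le_sup_seminorm_apply (𝕜 := ℝ)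
    (m := (k, l)) le_rfl le_rfl u x⟩

theorem exists_one_add_norm_pow_mul_le (u : 𝓢(E, F)) (k : ℕ) :
    ∃ C : ℝ, 0 ≤ C ∧ ∀ x, (1 + ‖x‖) ^ k * ‖u x‖ ≤ C := by
  obtain ⟨C, hC, h⟩ := exists_one_add_norm_pow_mul_iteratedFDeriv_le u k 0
  exact ⟨C, hC, fun x => by simpa using h x⟩

/-- A series of Schwartz functions which converges absolutely for every seminorm converges. -/
theorem exists_hasSum_of_summable_seminorm [CompleteSpace F] {ι : Type*} (u : ι → 𝓢(E, F))
    (hu : ∀ k l : ℕ, Summable fun i => SchwartzMap.seminorm ℝ k l (u i)) :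
    ∃ v : 𝓢(E, F), HasSum u v := by
  have hb : ∀ (k : ℕ) (i : ι) (x : E), ((k : ℕ∞) ≤ (⊤ : ℕ∞)) →
      ‖iteratedFDeriv ℝ k (u i) x‖ ≤ SchwartzMap.seminorm ℝ 0 k (u i) := fun k i x _ => by
    simpa using (u i).le_seminorm ℝ 0 k x
  have hD : ∀ (k : ℕ) (x : E), iteratedFDeriv ℝ k (fun y => ∑' i, u i y) x =
      ∑' i, iteratedFDeriv ℝ k (u i) x := fun k x =>
    iteratedFDeriv_tsum_apply (N := (⊤ : ℕ∞)) (fun i => (u i).smooth ⊤) (fun k _ => hu 0 k) hb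
      le_top x
  have hs : ∀ (k l : ℕ) (x : E),
      Summable fun i => ‖x‖ ^ k * ‖iteratedFDeriv ℝ l (u i) x‖ := fun k l x =>
    (hu k l).of_nonneg_of_le (fun i => by positivity) fun i => (u i).le_seminorm ℝ k l x
  have hs' : ∀ (l : ℕ) (x : E), Summable fun i => iteratedFDeriv ℝ l (u i) x := fun l x =>
    Summable.of_norm (by simpa using hs 0 l x)
  let v : 𝓢(E, F) :=
    { toFun := fun x => ∑' i, u i x
      smooth' := contDiff_tsum (N := (⊤ : ℕ∞)) (fun i => (u i).smooth ⊤) (fun k _ => hu 0 k) hb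
      decay' := fun k l => ⟨∑' i, SchwartzMap.seminorm ℝ k l (u i), fun x => by
        rw [hD]
        calc ‖x‖ ^ k * ‖∑' i, iteratedFDeriv ℝ l (u i) x‖
            ≤ ‖x‖ ^ k * ∑' i, ‖iteratedFDeriv ℝ l (u i) x‖ := by
              gcongr
              exact norm_tsum_le_tsum_norm (by simpa using hs 0 l x)
          _ = ∑' i, ‖x‖ ^ k * ‖iteratedFDeriv ℝ l (u i) x‖ := tsum_mul_left.symm
          _ ≤ _ := (hs k l x).tsum_le_tsum (fun i => (u i).le_seminorm ℝ k l x) (hu k l)⟩ }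
  refine ⟨v, ?_⟩
  have hw := schwartz_withSeminorms ℝ E F
  rw [HasSum, SummationFilter.unconditional_filter, hw.tendsto_nhds]
  rintro ⟨k, l⟩ ε hε
  -- Each seminorm of the error of a partial sum is at most the tail of the series of seminorms.
  have htail := tendsto_tsum_compl_atTop_zero (fun i => SchwartzMap.seminorm ℝ k l (u i))
  filter_upwards [htail.eventually (gt_mem_nhds hε)] with s hs0
  refine lt_of_le_of_lt ?_ hs0
  refine SchwartzMap.seminorm_le_bound ℝ k l _ (tsum_nonneg fun i => by positivity) fun x => ?_
  have hsum : iteratedFDeriv ℝ l (⇑(∑ i ∈ s, u i - v)) x =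
      -∑' i : { i // i ∉ s }, iteratedFDeriv ℝ l (u i) x := by
    have h1 : (⇑(∑ i ∈ s, u i - v)) = (fun y => ∑ i ∈ s, u i y) - ⇑v := by
      ext y
      simp
    rw [h1, iteratedFDeriv_sub_apply (ContDiff.contDiffAt (ContDiff.sum fun i _ => (u i).smooth l))
      (v.smooth l).contDiffAt, iteratedFDeriv_sum fun i _ => (u i).smooth l,
      show iteratedFDeriv ℝ l v x = _ from hD l x, ← (hs' l x).sum_add_tsum_subtype_compl s]
    simp
  rw [hsum, norm_neg]
  calc ‖x‖ ^ k * ‖∑' i : { i // i ∉ s }, iteratedFDeriv ℝ l (u i) x‖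
      ≤ ‖x‖ ^ k * ∑' i : { i // i ∉ s }, ‖iteratedFDeriv ℝ l (u i) x‖ := by
        gcongr
        exact norm_tsum_le_tsum_norm ((by simpa using hs 0 l x :
          Summable fun i => ‖iteratedFDeriv ℝ l (u i) x‖).subtype _)
    _ = ∑' i : { i // i ∉ s }, ‖x‖ ^ k * ‖iteratedFDeriv ℝ l (u i) x‖ := tsum_mul_left.symm
    _ ≤ _ := ((hs k l x).subtype _).tsum_le_tsum (fun i => (u i).le_seminorm ℝ k l x)
        ((hu k l).subtype _)

/-- Schwartz convergence implies uniform convergence. This identifies limits in the Schwartz space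
by their pointwise values. -/
theorem hasSum_apply {ι : Type*} {u : ι → 𝓢(E, ℂ)} {v : 𝓢(E, ℂ)} (h : HasSum u v) (x : E) :
    HasSum (fun i => u i x) (v x) := by
  have h1 := h.mapL (SchwartzMap.toBoundedContinuousFunctionCLM ℝ E ℂ)
  exact h1.mapL (BoundedContinuousFunction.evalCLM ℝ x)

/-- A Peetre-type inequality, used to trade decay in the variable for decay in the shift. -/
theorem one_add_norm_le_mul_one_add_norm_sub {E : Type*} [NormedAddCommGroup E] (a x : E) :
    1 + ‖a‖ ≤ (1 + ‖x‖) * (1 + ‖x - a‖) := by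
  have h : ‖a‖ ≤ ‖x‖ + ‖x - a‖ := by
    calc ‖a‖ = ‖x - (x - a)‖ := by simp
      _ ≤ _ := norm_sub_le _ _
  nlinarith [mul_nonneg (norm_nonneg x) (norm_nonneg (x - a))]

theorem iteratedFDeriv_compSubConstCLM (u : 𝓢(E, ℂ)) (a : E) (l : ℕ) (x : E) :
    iteratedFDeriv ℝ l (SchwartzMap.compSubConstCLM ℂ a u) x = iteratedFDeriv ℝ l u (x - a) :=
  iteratedFDeriv_comp_sub (𝕜 := ℝ) (f := u) l a x

/-- The seminorms of the translates of a Schwartz function grow polynomially. -/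
theorem exists_seminorm_compSubConstCLM_le (u : 𝓢(E, ℂ)) (k l : ℕ) :
    ∃ C : ℝ, 0 ≤ C ∧ ∀ a : E,
      SchwartzMap.seminorm ℝ k l (SchwartzMap.compSubConstCLM ℂ a u) ≤ C * (1 + ‖a‖) ^ k := by
  obtain ⟨C, hC, h⟩ := exists_one_add_norm_pow_mul_iteratedFDeriv_le u k l
  refine ⟨C, hC, fun a => SchwartzMap.seminorm_le_bound ℝ k l _ (by positivity) fun x => ?_⟩
  rw [iteratedFDeriv_compSubConstCLM]
  have h1 : ‖x‖ ≤ (1 + ‖a‖) * (1 + ‖x - a‖) := by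
    have h0 := one_add_norm_le_mul_one_add_norm_sub x a
    rw [norm_sub_rev] at h0
    linarith
  calc ‖x‖ ^ k * ‖iteratedFDeriv ℝ l u (x - a)‖
      ≤ ((1 + ‖a‖) * (1 + ‖x - a‖)) ^ k * ‖iteratedFDeriv ℝ l u (x - a)‖ := by gcongr
    _ = (1 + ‖a‖) ^ k * ((1 + ‖x - a‖) ^ k * ‖iteratedFDeriv ℝ l u (x - a)‖) := by
        rw [mul_pow]; ring
    _ ≤ (1 + ‖a‖) ^ k * C := by gcongr; exact h _
    _ = _ := mul_comm _ _

/-- The seminorms of `u · v(· - a)` decay rapidly in `a`. -/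
theorem exists_seminorm_smulLeftCLM_compSubConstCLM_le (u v : 𝓢(E, ℂ)) (N k l : ℕ) :
    ∃ C : ℝ, 0 ≤ C ∧ ∀ a : E, SchwartzMap.seminorm ℝ k l
      (SchwartzMap.smulLeftCLM ℂ u (SchwartzMap.compSubConstCLM ℂ a v)) ≤
        C * ((1 + ‖a‖) ^ N)⁻¹ := by
  choose A hA hAu using fun i => exists_one_add_norm_pow_mul_iteratedFDeriv_le u (k + N) i
  choose B hB hBv using fun i => exists_one_add_norm_pow_mul_iteratedFDeriv_le v N i
  refine ⟨∑ i ∈ Finset.range (l + 1), (l.choose i : ℝ) * (A i * B (l - i)),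
    Finset.sum_nonneg fun i _ => mul_nonneg (by positivity) (mul_nonneg (hA i) (hB _)),
    fun a => SchwartzMap.seminorm_le_bound ℝ k l _
      (mul_nonneg (Finset.sum_nonneg fun i _ => mul_nonneg (by positivity)
        (mul_nonneg (hA i) (hB _))) (by positivity)) fun x => ?_⟩
  have hfun : ⇑(SchwartzMap.smulLeftCLM ℂ u (SchwartzMap.compSubConstCLM ℂ a v)) =
      fun y => u y * (SchwartzMap.compSubConstCLM ℂ a v) y := by
    ext y
    rw [SchwartzMap.smulLeftCLM_apply_apply u.hasTemperateGrowth, smul_eq_mul]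
  rw [hfun, ← div_eq_mul_inv, le_div_iff₀ (by positivity)]
  have hle := norm_iteratedFDeriv_mul_le (𝕜 := ℝ) (N := (l : ℕ∞)) (u.smooth l)
    ((SchwartzMap.compSubConstCLM ℂ a v).smooth l) x le_rfl
  calc _ ≤ ‖x‖ ^ k * (∑ i ∈ Finset.range (l + 1), (l.choose i : ℝ) * ‖iteratedFDeriv ℝ i u x‖ *
        ‖iteratedFDeriv ℝ (l - i) (SchwartzMap.compSubConstCLM ℂ a v) x‖) * (1 + ‖a‖) ^ N := by
        gcongr
    _ = ∑ i ∈ Finset.range (l + 1), (l.choose i : ℝ) * (‖x‖ ^ k * (1 + ‖a‖) ^ N *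
        ‖iteratedFDeriv ℝ i u x‖ * ‖iteratedFDeriv ℝ (l - i) v (x - a)‖) := by
        rw [Finset.mul_sum, Finset.sum_mul]
        refine Finset.sum_congr rfl fun i _ => ?_
        rw [iteratedFDeriv_compSubConstCLM]
        ring
    _ ≤ _ := by
        refine Finset.sum_le_sum fun i _ => mul_le_mul_of_nonneg_left ?_ (by positivity)
        calc _ ≤ (1 + ‖x‖) ^ k * ((1 + ‖x‖) * (1 + ‖x - a‖)) ^ N *
              ‖iteratedFDeriv ℝ i u x‖ * ‖iteratedFDeriv ℝ (l - i) v (x - a)‖ := by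
              gcongr
              · linarith [norm_nonneg x]
              · exact one_add_norm_le_mul_one_add_norm_sub a x
          _ = ((1 + ‖x‖) ^ (k + N) * ‖iteratedFDeriv ℝ i u x‖) *
              ((1 + ‖x - a‖) ^ N * ‖iteratedFDeriv ℝ (l - i) v (x - a)‖) := by
              rw [mul_pow]; ring
          _ ≤ _ := mul_le_mul (hAu i x) (hBv _ _) (by positivity) (hA i)

end Schwartz

/-! ### The integer lattice and summability over it. -/

section Lattice

variable {n : ℕ}

theorem latticePoint_apply (α : Fin n → ℤ) (j : Fin n) : latticePoint α j = (α j : ℝ) := rfl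

theorem latticePoint_add (α β : Fin n → ℤ) :
    latticePoint (α + β) = latticePoint α + latticePoint β := by
  ext j; simp [latticePoint_apply]

theorem latticePoint_neg (α : Fin n → ℤ) : latticePoint (-α) = -latticePoint α := by
  ext j; simp [latticePoint_apply]

theorem latticePoint_sub (α β : Fin n → ℤ) :
    latticePoint (α - β) = latticePoint α - latticePoint β := by
  ext j; simp [latticePoint_apply]

theorem latticePoint_injective : Function.Injective (latticePoint (n := n)) := fun α β h => by
  funext j
  have := congrArg (fun v : Rn n => v j) h
  simpa [latticePoint_apply] using this

theorem one_le_norm_latticePoint {α : Fin n → ℤ} (hα : α ≠ 0) : 1 ≤ ‖latticePoint α‖ := by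
  obtain ⟨j, hj⟩ := Function.ne_iff.mp hα
  calc (1 : ℝ) ≤ |(α j : ℝ)| := by exact_mod_cast Int.one_le_abs hj
    _ = ‖latticePoint α j‖ := rfl
    _ ≤ _ := PiLp.norm_apply_le _ _

theorem summable_one_add_norm_latticePoint_inv :
    Summable fun α : Fin n → ℤ => ((1 + ‖latticePoint α‖) ^ (n + 1))⁻¹ := by
  let b := (EuclideanSpace.basisFun (Fin n) ℝ).toBasis
  let L := Submodule.span ℤ (Set.range b)
  have hr : Module.finrank ℤ L = n := by
    rw [ZLattice.rank ℝ L]; simp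
  have hmem : ∀ α : Fin n → ℤ, latticePoint α ∈ L := fun α => by
    have : latticePoint α = ∑ j, α j • b j := by
      ext i
      simp [b, latticePoint_apply, Finset.sum_apply, Pi.single_apply]
    rw [this]
    exact Submodule.sum_mem _ fun j _ => Submodule.smul_mem _ _ (Submodule.subset_span ⟨j, rfl⟩)
  have hs := ZLattice.summable_norm_pow_inv L (n + 1) (by rw [hr]; exact n.lt_succ_self)
  have hs' := hs.comp_injective (i := fun α : Fin n → ℤ => (⟨latticePoint α, hmem α⟩ : L))
    fun α β h => latticePoint_injective (congrArg Subtype.val h)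
  -- At `α = 0` the comparison term is zero by the convention `0⁻¹ = 0`, so the bound holds only off
  -- the origin.
  refine Summable.of_norm_bounded_eventually hs' ?_
  filter_upwards [(Set.finite_singleton (0 : Fin n → ℤ)).compl_mem_cofinite] with α hα
  have h1 := one_le_norm_latticePoint hα
  rw [Real.norm_of_nonneg (by positivity), Function.comp_apply, inv_pow]
  change _ ≤ (‖latticePoint α‖ ^ (n + 1))⁻¹
  gcongr
  linarith

theorem inner_latticePoint (α : Fin n → ℤ) (x : Rn n) :
    inner ℝ (latticePoint α) x = ∑ j, (α j : ℝ) * x j := by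
  simp [PiLp.inner_apply, latticePoint_apply, mul_comm]

end Lattice

/-! ### Periodization and its Fourier coefficients on the torus. -/

section Poisson

variable {n : ℕ}

/-- The class in the torus `ℝⁿ / ℤⁿ` of a point of `ℝⁿ`. -/
def toTorus (t : Fin n → ℝ) : UnitAddTorus (Fin n) := fun j => (t j : UnitAddCircle)

theorem isOpenQuotientMap_toTorus : IsOpenQuotientMap (toTorus (n := n)) :=
  IsOpenQuotientMap.piMap fun _ => QuotientAddGroup.isOpenQuotientMap_mk

theorem toTorus_add_intCast (t : Fin n → ℝ) (β : Fin n → ℤ) :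
    toTorus (t + fun j => (β j : ℝ)) = toTorus t := by
  funext j
  simp [toTorus]

theorem mFourier_toTorus (α : Fin n → ℤ) (t : Fin n → ℝ) :
    UnitAddTorus.mFourier α (toTorus t) =
      Complex.exp (((inner ℝ (latticePoint α) ((2 * π) • WithLp.toLp 2 t) : ℝ) : ℂ) * I) := by
  rw [inner_latticePoint]
  simp only [UnitAddTorus.mFourier, toTorus, ContinuousMap.coe_mk, fourier_coe_apply,
    PiLp.smul_apply, smul_eq_mul]
  rw [← Complex.exp_sum]
  push_cast
  rw [Finset.sum_mul]
  congr 1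
  refine Finset.sum_congr rfl fun j _ => ?_
  simp
  ring

/-- The half-open unit cube with corner `a`. -/
def unitCube (a : Fin n → ℝ) : Set (Fin n → ℝ) := {t | ∀ j, t j ∈ Set.Ioc (a j) (a j + 1)}

theorem measurableSet_unitCube (a : Fin n → ℝ) : MeasurableSet (unitCube a) :=
  MeasurableSet.univ_pi' fun _ => measurableSet_Ioc

theorem pairwise_disjoint_unitCube :
    Pairwise (Function.onFun Disjoint fun β : Fin n → ℤ => unitCube fun j => (β j : ℝ)) := by
  intro α β h
  refine Set.disjoint_left.mpr fun t hα hβ => h (funext fun j => ?_)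
  have h1 := hα j
  have h2 := hβ j
  have h3 : (α j : ℝ) < (β j + 1 : ℤ) := by push_cast; exact h1.1.trans_le h2.2
  have h4 : (β j : ℝ) < (α j + 1 : ℤ) := by push_cast; exact h2.1.trans_le h1.2
  have h5 : α j < β j + 1 := by exact_mod_cast h3
  have h6 : β j < α j + 1 := by exact_mod_cast h4
  omega

theorem iUnion_unitCube : ⋃ β : Fin n → ℤ, unitCube (fun j => (β j : ℝ)) = Set.univ := by
  -- The cubes are open on the left and closed on the right, hence `⌈t j⌉ - 1` instead of the floor.
  refine Set.eq_univ_of_forall fun t => Set.mem_iUnion.mpr ⟨fun j => ⌈t j⌉ - 1, fun j => ?_⟩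
  have h1 := Int.le_ceil (t j)
  have h2 := Int.ceil_lt_add_one (t j)
  push_cast
  constructor <;> linarith

theorem setIntegral_unitCube_intCast {G : Type*} [NormedAddCommGroup G] [NormedSpace ℝ G]
    (W : (Fin n → ℝ) → G) (β : Fin n → ℤ) :
    ∫ t in unitCube fun j => (β j : ℝ), W t =
      ∫ t in unitCube (0 : Fin n → ℝ), W (t + fun j => (β j : ℝ)) := by
  have h := (measurePreserving_add_right volume
    (fun j => (β j : ℝ) : Fin n → ℝ)).setIntegral_preimage_emb
    (MeasurableEquiv.addRight _).measurableEmbedding W (unitCube fun j => (β j : ℝ))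
  rw [← h]
  congr 2
  ext t
  simp only [unitCube, Set.mem_preimage, Set.mem_ofPred_eq, Set.mem_Ioc, Pi.add_apply,
    Pi.zero_apply]
  refine forall_congr' fun j => ?_
  constructor <;> rintro ⟨h1, h2⟩ <;> constructor <;> linarith

/-- The integral over `ℝⁿ` is the integral over the unit cube of the sum of the lattice
translates. -/
theorem integral_unitCube_tsum {W : (Fin n → ℝ) → ℂ} (hW : Integrable W) :
    ∫ t in unitCube (0 : Fin n → ℝ), ∑' β : Fin n → ℤ, W (t + fun j => (β j : ℝ)) =
      ∫ t, W t := by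
  have hm : ∀ β : Fin n → ℤ, MeasurableSet (unitCube fun j => (β j : ℝ)) :=
    fun β => measurableSet_unitCube _
  have h1 := hasSum_integral_iUnion hm pairwise_disjoint_unitCube hW.integrableOn
  have h2 := hasSum_integral_iUnion hm pairwise_disjoint_unitCube hW.norm.integrableOn
  rw [iUnion_unitCube, setIntegral_univ] at h1 h2
  simp only [setIntegral_unitCube_intCast] at h1 h2
  refine (hasSum_integral_of_summable_integral_norm (fun β => ?_) h2.summable).unique h1
  exact (hW.comp_add_right _).integrableOn

/-- The function `t ↦ ψ (2π t)` on `Fin n → ℝ`. -/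
noncomputable def dilate (ψ : 𝓢(Rn n, ℂ)) (t : Fin n → ℝ) : ℂ := ψ ((2 * π) • WithLp.toLp 2 t)

theorem continuous_dilate (ψ : 𝓢(Rn n, ℂ)) : Continuous (dilate ψ) :=
  ψ.continuous.comp (by fun_prop)

theorem integrable_dilate (ψ : 𝓢(Rn n, ℂ)) : Integrable (dilate ψ) := by
  have h : Integrable (fun x : Rn n => ψ ((2 * π) • x)) :=
    (ψ.integrable (μ := volume)).comp_smul (by positivity)
  exact (EuclideanSpace.volume_preserving_symm_measurableEquiv_toLp (Fin n)).symm.integrable_comp_emb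
    (MeasurableEquiv.measurableEmbedding _) |>.mpr h

/-- The Weierstrass majorant for the periodization, uniform for `x` in bounded sets. -/
theorem exists_norm_translate_le (ψ : 𝓢(Rn n, ℂ)) :
    ∃ C : ℝ, 0 ≤ C ∧ ∀ (x : Rn n) (β : Fin n → ℤ), ‖ψ (x + (2 * π) • latticePoint β)‖ ≤
      C * (1 + ‖x‖) ^ (n + 1) * ((1 + ‖latticePoint β‖) ^ (n + 1))⁻¹ := by
  obtain ⟨C, hC, h⟩ := exists_one_add_norm_pow_mul_le ψ (n + 1)
  refine ⟨C, hC, fun x β => ?_⟩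
  rw [← div_eq_mul_inv, le_div_iff₀ (by positivity)]
  have h1 : 1 + ‖latticePoint β‖ ≤ (1 + ‖x‖) * (1 + ‖x + (2 * π) • latticePoint β‖) := by
    have h2 := one_add_norm_le_mul_one_add_norm_sub (-((2 * π) • latticePoint β)) x
    rw [norm_neg, sub_neg_eq_add, norm_smul] at h2
    have h3 : (1 : ℝ) ≤ ‖(2 * π : ℝ)‖ := by
      rw [Real.norm_of_nonneg (by positivity)]
      linarith [Real.pi_gt_three]
    nlinarith [norm_nonneg (latticePoint β)]
  calc _ ≤ ‖ψ (x + (2 * π) • latticePoint β)‖ *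
        ((1 + ‖x‖) * (1 + ‖x + (2 * π) • latticePoint β‖)) ^ (n + 1) := by gcongr
    _ = (1 + ‖x‖) ^ (n + 1) * ((1 + ‖x + (2 * π) • latticePoint β‖) ^ (n + 1) *
        ‖ψ (x + (2 * π) • latticePoint β)‖) := by rw [mul_pow]; ring
    _ ≤ (1 + ‖x‖) ^ (n + 1) * C := by gcongr; exact h _
    _ = _ := mul_comm _ _

theorem dilate_add_intCast (ψ : 𝓢(Rn n, ℂ)) (t : Fin n → ℝ) (β : Fin n → ℤ) :
    dilate ψ (t + fun j => (β j : ℝ)) =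
      ψ ((2 * π) • WithLp.toLp 2 t + (2 * π) • latticePoint β) := by
  rw [dilate, ← smul_add]
  rfl

/-- The sum of the translates of `ψ (2π ·)` by `ℤⁿ`. -/
noncomputable def periodization (ψ : 𝓢(Rn n, ℂ)) (t : Fin n → ℝ) : ℂ :=
  ∑' β : Fin n → ℤ, dilate ψ (t + fun j => (β j : ℝ))

theorem continuous_periodization (ψ : 𝓢(Rn n, ℂ)) : Continuous (periodization ψ) := by
  obtain ⟨C, hC, h⟩ := exists_norm_translate_le ψ
  refine continuous_iff_continuousAt.mpr fun t₀ => ?_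
  let T : (Fin n → ℝ) → Rn n := fun t => (2 * π) • WithLp.toLp 2 t
  have hT : Continuous T := by fun_prop
  refine ContinuousOn.continuousAt (s := {t | ‖T t‖ < ‖T t₀‖ + 1}) ?_
    ((isOpen_lt hT.norm continuous_const).mem_nhds (by simp))
  refine continuousOn_tsum (u := fun β => C * (1 + (‖T t₀‖ + 1)) ^ (n + 1) *
    ((1 + ‖latticePoint β‖) ^ (n + 1))⁻¹) (fun β => ?_)
    (summable_one_add_norm_latticePoint_inv.mul_left _) fun β t ht => ?_
  · exact ((continuous_dilate ψ).comp (continuous_id.add continuous_const)).continuousOn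
  · rw [dilate_add_intCast]
    refine (h _ β).trans ?_
    have : ‖T t‖ ≤ ‖T t₀‖ + 1 := le_of_lt ht
    gcongr

theorem periodization_add_intCast (ψ : 𝓢(Rn n, ℂ)) (t : Fin n → ℝ) (γ : Fin n → ℤ) :
    periodization ψ (t + fun j => (γ j : ℝ)) = periodization ψ t := by
  rw [periodization, periodization, ← (Equiv.addLeft γ).tsum_eq (fun β => dilate ψ (t + fun j => (β j : ℝ)))]
  congr 1
  funext β
  congr 1
  funext j
  simp [add_assoc]

/-- A continuous periodic function descends continuously because the projection to the torus is a
quotient map. -/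
theorem exists_continuousMap_toTorus (ψ : 𝓢(Rn n, ℂ)) :
    ∃ G : C(UnitAddTorus (Fin n), ℂ), ∀ t, G (toTorus t) = periodization ψ t := by
  have hf : Function.FactorsThrough (periodization ψ) toTorus := fun s t hst => by
    have h : ∀ j, ∃ m : ℤ, s j = t j + m := fun j => by
      have h1 := congrFun hst j
      obtain ⟨m, hm⟩ := (AddCircle.coe_eq_zero_iff 1 (x := s j - t j)).mp
        (by rw [AddCircle.coe_sub]; exact sub_eq_zero.mpr h1)
      exact ⟨m, by rw [zsmul_one] at hm; linarith⟩
    choose γ hγ using h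
    rw [show s = t + fun j => (γ j : ℝ) from funext hγ, periodization_add_intCast]
  let q : C(Fin n → ℝ, UnitAddTorus (Fin n)) := ⟨toTorus, isOpenQuotientMap_toTorus.continuous⟩
  have hq : Topology.IsQuotientMap q := isOpenQuotientMap_toTorus.isQuotientMap
  let p : C(Fin n → ℝ, ℂ) := ⟨periodization ψ, continuous_periodization ψ⟩
  exact ⟨hq.lift p hf, fun t => DFunLike.congr_fun (hq.lift_comp p hf) t⟩

/-- Unfolding: the character is invariant under integer translations, so the cube integral of the
lattice sum becomes an integral over the whole space; the substitution `x = 2πt` yields the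
constant. The index is `-α` because the coefficient integrates against the conjugate character. -/
theorem mFourierCoeff_of_toTorus {ψ : 𝓢(Rn n, ℂ)} {G : UnitAddTorus (Fin n) → ℂ}
    (hG : ∀ t, G (toTorus t) = periodization ψ t) (α : Fin n → ℤ) :
    UnitAddTorus.mFourierCoeff G (-α) = (((2 * π) ^ n)⁻¹ : ℝ) * character α ψ := by
  let W : (Fin n → ℝ) → ℂ := fun t => UnitAddTorus.mFourier α (toTorus t) * dilate ψ t
  have hc : Continuous fun t : Fin n → ℝ => UnitAddTorus.mFourier α (toTorus t) :=
    (map_continuous _).comp isOpenQuotientMap_toTorus.continuous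
  have hW : Integrable W := by
    refine (integrable_dilate ψ).bdd_mul (c := 1) hc.aestronglyMeasurable
      (Filter.Eventually.of_forall fun t => ?_)
    exact ((UnitAddTorus.mFourier α).norm_coe_le_norm _).trans UnitAddTorus.mFourier_norm.le
  rw [UnitAddTorus.mFourierCoeff_eq_integral G (-α) 0, neg_neg]
  have h1 : ∀ t : Fin n → ℝ, UnitAddTorus.mFourier α (fun i => (t i : UnitAddCircle)) •
      G (fun i => (t i : UnitAddCircle)) = ∑' β : Fin n → ℤ, W (t + fun j => (β j : ℝ)) := by
    intro t
    change UnitAddTorus.mFourier α (toTorus t) • G (toTorus t) = _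
    rw [hG, periodization, smul_eq_mul, ← tsum_mul_left]
    congr 1
    funext β
    simp only [W, toTorus_add_intCast]
  simp only [h1]
  refine (integral_unitCube_tsum hW).trans ?_
  have h2 := (EuclideanSpace.volume_preserving_symm_measurableEquiv_toLp
    (Fin n)).symm.integral_comp (MeasurableEquiv.measurableEmbedding _)
    (fun x : Rn n => ψ ((2 * π) • x) *
      Complex.exp (((inner ℝ (latticePoint α) ((2 * π) • x) : ℝ) : ℂ) * I))
  have h3 := Measure.integral_comp_smul (volume : Measure (Rn n))
    (fun x : Rn n => ψ x * Complex.exp (((inner ℝ (latticePoint α) x : ℝ) : ℂ) * I)) (2 * π)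
  rw [h3] at h2
  rw [character_apply]
  simp only [finrank_euclideanSpace, Fintype.card_fin] at h2
  rw [abs_of_nonneg (by positivity), Complex.real_smul] at h2
  rw [← h2]
  congr 1
  funext t
  simp only [W, mFourier_toTorus, dilate]
  exact mul_comm _ _

end Poisson

/-! ### Poisson summation and the Fourier series of a periodic distribution. -/

section FourierSeries

variable {n : ℕ}

theorem fourier_apply_eq_integral (ψ : 𝓢(Rn n, ℂ)) (w : Rn n) :
    𝓕 ψ w = ∫ x, ψ x * Complex.exp (((-(2 * π * inner ℝ w x) : ℝ) : ℂ) * I) := by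
  rw [SchwartzMap.fourier_coe, Real.fourier_eq']
  congr 1
  funext x
  rw [smul_eq_mul, mul_comm, real_inner_comm]
  congr 4
  ring

/-- Pairings with characters are samples of a Schwartz function, hence rapidly decreasing in `α`.
The factor and sign come from the kernel `e^{-2πi x·w}` of `𝓕`. -/
theorem character_eq_fourier (α : Fin n → ℤ) (ψ : 𝓢(Rn n, ℂ)) :
    character α ψ = 𝓕 ψ (-((2 * π)⁻¹ • latticePoint α)) := by
  rw [fourier_apply_eq_integral, character_apply]
  congr 1
  funext x
  rw [inner_neg_left, real_inner_smul_left]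
  congr 4
  have := Real.pi_ne_zero
  field_simp

theorem fourier_demodulate (ξ : Rn n) (ψ : 𝓢(Rn n, ℂ)) :
    𝓕 (demodulate ξ ψ) = SchwartzMap.compSubConstCLM ℂ (-((2 * π)⁻¹ • ξ)) (𝓕 ψ) := by
  ext w
  rw [SchwartzMap.compSubConstCLM_apply, sub_neg_eq_add, fourier_apply_eq_integral,
    fourier_apply_eq_integral]
  congr 1
  funext x
  rw [demodulate_apply, mul_assoc, ← Complex.exp_add, inner_add_left, real_inner_smul_left]
  congr 2
  have : (π : ℂ) ≠ 0 := by exact_mod_cast Real.pi_ne_zero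
  push_cast
  field_simp
  ring

theorem exists_norm_comp_inv_two_pi_smul_le (ψ : 𝓢(Rn n, ℂ)) (N : ℕ) :
    ∃ C : ℝ, 0 ≤ C ∧ ∀ η : Rn n, ‖ψ ((2 * π)⁻¹ • η)‖ ≤ C * ((1 + ‖η‖) ^ N)⁻¹ := by
  obtain ⟨C, hC, h⟩ := exists_one_add_norm_pow_mul_le ψ N
  refine ⟨C * (2 * π) ^ N, by positivity, fun η => ?_⟩
  rw [← div_eq_mul_inv, le_div_iff₀ (by positivity)]
  set w := (2 * π)⁻¹ • η with hw
  have h1 : 1 + ‖η‖ ≤ (2 * π) * (1 + ‖w‖) := by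
    rw [hw, norm_smul, Real.norm_of_nonneg (by positivity), mul_add, ← mul_assoc,
      mul_inv_cancel₀ (by positivity)]
    linarith [Real.pi_gt_three]
  calc ‖ψ w‖ * (1 + ‖η‖) ^ N
      ≤ ‖ψ w‖ * ((2 * π) * (1 + ‖w‖)) ^ N := by gcongr
    _ = ((1 + ‖w‖) ^ N * ‖ψ w‖) * (2 * π) ^ N := by rw [mul_pow]; ring
    _ ≤ _ := by gcongr; exact h _

theorem exists_norm_character_le (ψ : 𝓢(Rn n, ℂ)) (N : ℕ) :
    ∃ C : ℝ, 0 ≤ C ∧ ∀ α, ‖character α ψ‖ ≤ C * ((1 + ‖latticePoint α‖) ^ N)⁻¹ := by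
  obtain ⟨C, hC, h⟩ := exists_norm_comp_inv_two_pi_smul_le (𝓕 ψ) N
  refine ⟨C, hC, fun α => ?_⟩
  rw [character_eq_fourier, ← smul_neg]
  simpa using h (-latticePoint α)

theorem summable_norm_character (ψ : 𝓢(Rn n, ℂ)) : Summable fun α => ‖character α ψ‖ := by
  obtain ⟨C, hC, h⟩ := exists_norm_character_le ψ (n + 1)
  exact (summable_one_add_norm_latticePoint_inv.mul_left C).of_nonneg_of_le
    (fun _ => norm_nonneg _) h

theorem periodization_eq_tsum (ψ : 𝓢(Rn n, ℂ)) (x : Rn n) :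
    periodization ψ ((2 * π)⁻¹ • x.ofLp) =
      ∑' β : Fin n → ℤ, ψ (x - (2 * π) • latticePoint β) := by
  rw [periodization, ← (Equiv.neg (Fin n → ℤ)).tsum_eq]
  congr 1
  funext β
  rw [dilate_add_intCast, Equiv.neg_apply, latticePoint_neg, smul_neg, ← sub_eq_add_neg,
    WithLp.toLp_smul, smul_smul, mul_inv_cancel₀ (by positivity), one_smul]

/-- The Poisson summation formula for Schwartz functions on `ℝⁿ`. -/
theorem hasSum_character_mul_exp (ψ : 𝓢(Rn n, ℂ)) (x : Rn n) :
    HasSum (fun α : Fin n → ℤ => ((((2 * π) ^ n)⁻¹ : ℝ) : ℂ) * character α ψ *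
        Complex.exp (-(((inner ℝ (latticePoint α) x : ℝ) : ℂ) * I)))
      (∑' β : Fin n → ℤ, ψ (x - (2 * π) • latticePoint β)) := by
  obtain ⟨G, hG⟩ := exists_continuousMap_toTorus ψ
  -- Absolute summability of the coefficients makes the Fourier series of the continuous function
  -- `G` converge to it at every point.
  have hs : Summable (UnitAddTorus.mFourierCoeff G) := by
    rw [← (Equiv.neg (Fin n → ℤ)).summable_iff]
    refine Summable.of_norm ?_
    simp only [Function.comp_def, Equiv.neg_apply, mFourierCoeff_of_toTorus hG, norm_mul]
    exact (summable_norm_character ψ).mul_left _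
  have h := UnitAddTorus.hasSum_mFourier_series_apply_of_summable hs
    (toTorus ((2 * π)⁻¹ • x.ofLp))
  rw [hG, periodization_eq_tsum, ← (Equiv.neg (Fin n → ℤ)).hasSum_iff] at h
  convert! h using 2 with α
  simp only [Function.comp_apply, Equiv.neg_apply, mFourierCoeff_of_toTorus hG, smul_eq_mul,
    mFourier_toTorus, latticePoint_neg, inner_neg_left]
  rw [WithLp.toLp_smul, smul_smul, mul_inv_cancel₀ (by positivity), one_smul]
  push_cast
  rw [neg_mul]

theorem mFourierCoeff_one (α : Fin n → ℤ) :
    UnitAddTorus.mFourierCoeff (fun _ : UnitAddTorus (Fin n) => (1 : ℂ)) α =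
      if α = 0 then 1 else 0 := by
  have h := UnitAddTorus.mFourierBasis_repr (UnitAddTorus.mFourierLp 2 (0 : Fin n → ℤ)) α
  rw [UnitAddTorus.mFourierCoeff_toLp, UnitAddTorus.mFourier_zero,
    ← UnitAddTorus.coe_mFourierBasis, HilbertBasis.repr_self] at h
  refine Eq.trans h.symm ?_
  rw [lp.single_apply]
  by_cases hα : α = 0 <;> simp [hα]

/-- The periodization of `φ` is the constant one, so only its zeroth Fourier coefficient survives.
-/
theorem character_partition {φ : 𝓢(Rn n, ℂ)} (hφ : IsPeriodicPartition φ) (α : Fin n → ℤ) :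
    character α φ = if α = 0 then (((2 * π) ^ n : ℝ) : ℂ) else 0 := by
  have h1 : ∀ t, (fun _ : UnitAddTorus (Fin n) => (1 : ℂ)) (toTorus t) = periodization φ t := by
    intro t
    have h := periodization_eq_tsum φ (WithLp.toLp 2 ((2 * π) • t))
    rw [(hφ _).tsum_eq] at h
    rw [← h, smul_smul, inv_mul_cancel₀ (by positivity), one_smul]
  have h2 := mFourierCoeff_of_toTorus
    (G := fun _ : UnitAddTorus (Fin n) => (1 : ℂ)) h1 α
  rw [mFourierCoeff_one] at h2
  have h3 : (((2 * π) ^ n : ℝ) : ℂ) ≠ 0 := by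
    exact_mod_cast (by positivity : ((2 * π) ^ n : ℝ) ≠ 0)
  rw [Complex.ofReal_inv, eq_comm, inv_mul_eq_iff_eq_mul₀ h3] at h2
  rw [h2]
  simp

/-- Trigonometric series with rapidly decreasing coefficients, multiplied by a Schwartz function,
converge in the Schwartz space. -/
theorem exists_hasSum_smul_demodulate (φ : 𝓢(Rn n, ℂ)) {a : (Fin n → ℤ) → ℂ}
    (ha : ∀ N : ℕ, ∃ C : ℝ, 0 ≤ C ∧ ∀ α, ‖a α‖ ≤ C * ((1 + ‖latticePoint α‖) ^ N)⁻¹) :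
    ∃ v : 𝓢(Rn n, ℂ), HasSum (fun α => a α • demodulate (latticePoint α) φ) v := by
  -- The series is summed on the Fourier side, where modulations become translates with polynomially
  -- growing seminorms.
  obtain ⟨v, hv⟩ := exists_hasSum_of_summable_seminorm
    (fun α : Fin n → ℤ => a α • 𝓕 (demodulate (latticePoint α) φ)) fun k l => by
      -- The power `k` absorbs the growth of the seminorm; the remaining `n + 1` gives summability
      -- over the lattice.
      obtain ⟨C, hC, hCa⟩ := ha (k + (n + 1))
      obtain ⟨D, hD, hDu⟩ := exists_seminorm_compSubConstCLM_le (𝓕 φ) k l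
      refine (summable_one_add_norm_latticePoint_inv.mul_left (C * D)).of_nonneg_of_le
        (fun _ => apply_nonneg _ _) fun α => ?_
      change SchwartzMap.seminorm ℂ k l _ ≤ _
      rw [map_smul_eq_mul, fourier_demodulate]
      have h1 : ‖-((2 * π)⁻¹ • latticePoint α)‖ ≤ ‖latticePoint α‖ := by
        rw [norm_neg, norm_smul, Real.norm_of_nonneg (by positivity)]
        refine mul_le_of_le_one_left (norm_nonneg _) (inv_le_one_of_one_le₀ ?_)
        linarith [Real.pi_gt_three]
      have h2 : 0 < 1 + ‖latticePoint α‖ := by positivity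
      calc _ ≤ (C * ((1 + ‖latticePoint α‖) ^ (k + (n + 1)))⁻¹) *
            (D * (1 + ‖latticePoint α‖) ^ k) := by
            refine mul_le_mul (hCa α) ((hDu _).trans ?_) (apply_nonneg _ _) (by positivity)
            gcongr
        _ = _ := by
            rw [pow_add]
            field_simp
  refine ⟨𝓕⁻ v, ?_⟩
  have h := hv.mapL (FourierTransform.fourierInvCLM ℂ 𝓢(Rn n, ℂ))
  convert! h using 2 with α
  rw [map_smul]
  congr 1
  exact (FourierPair.fourierInv_fourier_eq (F := 𝓢(Rn n, ℂ))
    (demodulate (latticePoint α) φ)).symm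

theorem exists_hasSum_smulLeftCLM_translate (u v : 𝓢(Rn n, ℂ)) :
    ∃ w : 𝓢(Rn n, ℂ), HasSum (fun β : Fin n → ℤ => SchwartzMap.smulLeftCLM ℂ u
      (SchwartzMap.compSubConstCLM ℂ ((2 * π) • latticePoint β) v)) w := by
  refine exists_hasSum_of_summable_seminorm _ fun k l => ?_
  obtain ⟨C, hC, h⟩ := exists_seminorm_smulLeftCLM_compSubConstCLM_le u v (n + 1) k l
  refine (summable_one_add_norm_latticePoint_inv.mul_left C).of_nonneg_of_le
    (fun _ => apply_nonneg _ _) fun β => (h _).trans ?_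
  have h1 : ‖latticePoint β‖ ≤ ‖(2 * π) • latticePoint β‖ := by
    rw [norm_smul, Real.norm_of_nonneg (by positivity)]
    exact le_mul_of_one_le_left (norm_nonneg _) (by linarith [Real.pi_gt_three])
  gcongr

theorem IsPeriodic.translate_eq {f : 𝓢'(Rn n, ℂ)} (hf : IsPeriodic f) (β : Fin n → ℤ)
    (ψ : 𝓢(Rn n, ℂ)) :
    f (SchwartzMap.compSubConstCLM ℂ ((2 * π) • latticePoint β) ψ) = f ψ := by
  -- The shifts that leave `f` invariant form a group, so the generators suffice.
  let H : AddSubgroup (Rn n) :=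
    { carrier := {a | ∀ ψ : 𝓢(Rn n, ℂ), f (SchwartzMap.compSubConstCLM ℂ a ψ) = f ψ}
      zero_mem' := fun ψ => by simp
      add_mem' := fun {a b} ha hb ψ => by
        rw [← SchwartzMap.compSubConstCLM_comp, hb, ha]
      neg_mem' := fun {a} ha ψ => by
        have h := ha (SchwartzMap.compSubConstCLM ℂ (-a) ψ)
        rw [SchwartzMap.compSubConstCLM_comp, neg_add_cancel] at h
        simpa using h.symm }
  have hmem : (2 * π) • latticePoint β = ∑ j, β j • EuclideanSpace.single j (2 * π) := by
    ext i
    simp [latticePoint_apply, Finset.sum_apply, Pi.single_apply, mul_comm]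
  have h : (2 * π) • latticePoint β ∈ H := by
    rw [hmem]
    exact H.sum_mem fun j _ => H.zsmul_mem (hf j) _
  exact h ψ

theorem hasSum_pairing (f : 𝓢'(Rn n, ℂ)) {ι : Type*} {u : ι → 𝓢(Rn n, ℂ)} {v : 𝓢(Rn n, ℂ)}
    (h : HasSum u v) : HasSum (fun i => f (u i)) (f v) :=
  h.map f (map_continuous f)

/-- A periodic distribution paired with `ψ` is a sum over translates of `ψ` localized by `φ`. -/
theorem IsPeriodic.hasSum_localized {f : 𝓢'(Rn n, ℂ)} (hf : IsPeriodic f) {φ : 𝓢(Rn n, ℂ)}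
    (hφ : IsPeriodicPartition φ) (ψ : 𝓢(Rn n, ℂ)) :
    HasSum (fun β : Fin n → ℤ => f (SchwartzMap.smulLeftCLM ℂ φ
      (SchwartzMap.compSubConstCLM ℂ ((2 * π) • latticePoint β) ψ))) (f ψ) := by
  obtain ⟨w, hw⟩ := exists_hasSum_smulLeftCLM_translate ψ φ
  have hwψ : w = ψ := by
    ext x
    refine (hasSum_apply hw x).unique ?_
    simp only [SchwartzMap.smulLeftCLM_apply_apply ψ.hasTemperateGrowth,
      SchwartzMap.compSubConstCLM_apply, smul_eq_mul]
    simpa using (hφ x).mul_left (ψ x)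
  rw [hwψ] at hw
  have h := hasSum_pairing f hw
  rw [← (Equiv.neg (Fin n → ℤ)).hasSum_iff] at h
  convert! h using 2 with β
  -- Translating `ψ · φ(· + 2πβ)` by `2πβ` moves the shift from `φ` to `ψ`, and `f` does not see
  -- this translation.
  rw [Function.comp_apply, Equiv.neg_apply, ← hf.translate_eq β
    (SchwartzMap.smulLeftCLM ℂ ψ _)]
  congr 1
  ext x
  simp only [SchwartzMap.smulLeftCLM_apply_apply φ.hasTemperateGrowth,
    SchwartzMap.smulLeftCLM_apply_apply ψ.hasTemperateGrowth,
    SchwartzMap.compSubConstCLM_apply, smul_eq_mul, latticePoint_neg, smul_neg, sub_neg_eq_add,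
    sub_add_cancel, mul_comm]

theorem IsPeriodic.hasSum_fourierCoefficient_apply {f : 𝓢'(Rn n, ℂ)} (hf : IsPeriodic f)
    {φ : 𝓢(Rn n, ℂ)} (hφ : IsPeriodicPartition φ) (ψ : 𝓢(Rn n, ℂ)) :
    HasSum (fun α : Fin n → ℤ => fourierCoefficient φ f α * character α ψ) (f ψ) := by
  obtain ⟨v, hv⟩ := exists_hasSum_smul_demodulate φ
    (a := fun α => ((((2 * π) ^ n)⁻¹ : ℝ) : ℂ) * character α ψ) fun N => by
      obtain ⟨C, hC, h⟩ := exists_norm_character_le ψ N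
      refine ⟨((2 * π) ^ n)⁻¹ * C, by positivity, fun α => ?_⟩
      rw [norm_mul, Complex.norm_real, Real.norm_of_nonneg (by positivity), mul_assoc]
      gcongr
      exact h α
  obtain ⟨w, hw⟩ := exists_hasSum_smulLeftCLM_translate φ ψ
  -- `v` and `w` are the two sides of the Poisson formula multiplied by `φ`.
  have hvw : v = w := by
    ext x
    have h1 := hasSum_apply hv x
    have h2 := hasSum_apply hw x
    have h3 := (hasSum_character_mul_exp ψ x).mul_left (φ x)
    simp only [SchwartzMap.smulLeftCLM_apply_apply φ.hasTemperateGrowth,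
      SchwartzMap.compSubConstCLM_apply, smul_eq_mul] at h2
    rw [← h2.tsum_eq, tsum_mul_left]
    refine h1.unique ?_
    convert! h3 using 2 with α
    rw [smul_apply, demodulate_apply, smul_eq_mul]
    ring
  have h1 := hasSum_pairing f hv
  have h2 := hasSum_pairing f hw
  rw [hvw, h2.unique (hf.hasSum_localized hφ ψ)] at h1
  convert! h1 using 2 with α
  rw [map_smul, smul_eq_mul, fourierCoefficient]
  ring

theorem IsPeriodic.hasSum_fourierCoefficient_smul_character {f : 𝓢'(Rn n, ℂ)}
    (hf : IsPeriodic f) {φ : 𝓢(Rn n, ℂ)} (hφ : IsPeriodicPartition φ) :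
    HasSum (fun α : Fin n → ℤ => fourierCoefficient φ f α • character α) f := by
  rw [HasSum, PointwiseConvergenceCLM.tendsto_iff_forall_tendsto]
  intro ψ
  have h := hf.hasSum_fourierCoefficient_apply hφ ψ
  rw [HasSum] at h
  refine h.congr fun s => ?_
  rw [sum_apply]
  rfl

end FourierSeries

/-! ### The short-time Fourier transform as a trigonometric series. -/

section ShortTimeFourierTransform

variable {n : ℕ}

/-- The function `η ↦ ∫ conj (g y) e^{-i η·y} dy`. -/
noncomputable def windowTransform (g : 𝓢(Rn n, ℂ)) (η : Rn n) : ℂ :=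
  (𝓕 (SchwartzMap.postcompCLM (𝕜 := ℝ) (Complex.conjCLE : ℂ →L[ℝ] ℂ) g) : 𝓢(Rn n, ℂ))
    ((2 * π)⁻¹ • η)

theorem windowTransform_eq_integral (g : 𝓢(Rn n, ℂ)) (η : Rn n) :
    windowTransform g η =
      ∫ y, (starRingEnd ℂ) (g y) * Complex.exp (-(((inner ℝ η y : ℝ) : ℂ) * I)) := by
  rw [windowTransform, fourier_apply_eq_integral]
  congr 1
  funext y
  rw [SchwartzMap.postcompCLM_apply, real_inner_smul_left]
  have : (2 * π * ((2 * π)⁻¹ * inner ℝ η y) : ℝ) = inner ℝ η y := by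
    have := Real.pi_ne_zero
    field_simp
  rw [this]
  push_cast
  rw [neg_mul]
  rfl

theorem continuous_windowTransform (g : 𝓢(Rn n, ℂ)) : Continuous (windowTransform g) :=
  (SchwartzMap.continuous _).comp (by fun_prop)

/-- Injectivity of the Fourier transform on Schwartz functions. -/
theorem exists_windowTransform_ne_zero {g : 𝓢(Rn n, ℂ)} (hg : g ≠ 0) :
    ∃ η, windowTransform g η ≠ 0 := by
  by_contra! h
  refine hg ?_
  set u := SchwartzMap.postcompCLM (𝕜 := ℝ) (Complex.conjCLE : ℂ →L[ℝ] ℂ) g with hu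
  have h1 : 𝓕 u = 0 := by
    ext w
    have h2 := h ((2 * π) • w)
    rw [windowTransform, smul_smul, inv_mul_cancel₀ (by positivity), one_smul] at h2
    simpa using h2
  have h2 : u = 0 := by
    have h3 := FourierPair.fourierInv_fourier_eq (F := 𝓢(Rn n, ℂ)) u
    rw [h1] at h3
    rw [← h3]
    exact map_zero (FourierTransform.fourierInvCLM ℂ 𝓢(Rn n, ℂ))
  ext y
  have h3 := congrArg (fun v : 𝓢(Rn n, ℂ) => v y) h2
  simpa [hu] using h3

/-- The substitution `y ↦ y + x` leaves all dependence on `x` in a unimodular factor. -/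
theorem character_conjTimeFreqShift (g : 𝓢(Rn n, ℂ)) (x ξ : Rn n) (α : Fin n → ℤ) :
    character α (conjTimeFreqShift g x ξ) =
      windowTransform g (ξ - latticePoint α) *
        Complex.exp (-(((inner ℝ (ξ - latticePoint α) x : ℝ) : ℂ) * I)) := by
  rw [character_apply, ← integral_add_right_eq_self _ x, windowTransform_eq_integral,
    ← integral_mul_const]
  congr 1
  funext y
  rw [conjTimeFreqShift_apply, add_sub_cancel_right, mul_assoc, mul_assoc, ← Complex.exp_add,
    ← Complex.exp_add]
  congr 2
  simp only [inner_add_right, inner_sub_left]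
  push_cast
  ring

/-- The constant `(2π)^{-n/2}`. -/
noncomputable def stftConst (n : ℕ) : ℝ := (2 * π) ^ (-(n : ℝ) / 2)

theorem stftConst_pos : 0 < stftConst n := Real.rpow_pos_of_pos (by positivity) _

/-- The short-time Fourier transform of a periodic distribution as a Fourier series. -/
theorem IsPeriodic.hasSum_stft {f : 𝓢'(Rn n, ℂ)} (hf : IsPeriodic f) {φ : 𝓢(Rn n, ℂ)}
    (hφ : IsPeriodicPartition φ) (g : 𝓢(Rn n, ℂ)) (x ξ : Rn n) :
    HasSum (fun α : Fin n → ℤ => (stftConst n : ℂ) * (fourierCoefficient φ f α *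
        windowTransform g (ξ - latticePoint α)) *
        Complex.exp (-(((inner ℝ (ξ - latticePoint α) x : ℝ) : ℂ) * I)))
      (stft g f x ξ) := by
  have h := (hf.hasSum_fourierCoefficient_apply hφ (conjTimeFreqShift g x ξ)).mul_left
    (stftConst n : ℂ)
  convert! h using 2 with α
  rw [character_conjTimeFreqShift]
  ring

theorem norm_exp_neg_ofReal_mul_I (t : ℝ) : ‖Complex.exp (-((t : ℂ) * I))‖ = 1 := by
  rw [← neg_mul, ← Complex.ofReal_neg, Complex.norm_exp_ofReal_mul_I]

theorem weight_pos (s : ℝ) (x : Rn n) : 0 < weight s x := Real.rpow_pos_of_pos (by positivity) _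

theorem weight_zero (x : Rn n) : weight 0 x = 1 := by simp [weight]

/-- Peetre's inequality: `1 + |x|² ≤ 2 (1 + |y|²)(1 + |x - y|²)`, raised to the power `s / 2`. -/
theorem weight_le_mul {s : ℝ} (hs : 0 ≤ s) (x y : Rn n) :
    weight s x ≤ 2 ^ (s / 2) * (weight s y * weight s (x - y)) := by
  rw [weight, weight, weight, ← Real.mul_rpow (by positivity) (by positivity),
    ← Real.mul_rpow (by positivity) (by positivity)]
  refine Real.rpow_le_rpow (by positivity) ?_ (by positivity)
  have h : ‖x‖ ≤ ‖y‖ + ‖x - y‖ := by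
    calc ‖x‖ = ‖y + (x - y)‖ := by simp
      _ ≤ _ := norm_add_le _ _
  have h2 : ‖x‖ ^ 2 ≤ (‖y‖ + ‖x - y‖) ^ 2 := by gcongr
  nlinarith [sq_nonneg (‖y‖ - ‖x - y‖), mul_nonneg (sq_nonneg ‖y‖) (sq_nonneg ‖x - y‖)]

theorem weight_le_one_add_norm_pow {s : ℝ} (hs : 0 ≤ s) (x : Rn n) :
    weight s x ≤ (1 + ‖x‖) ^ ⌈s⌉₊ := by
  calc weight s x ≤ ((1 + ‖x‖) ^ (2 : ℕ)) ^ (s / 2) := by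
        refine Real.rpow_le_rpow (by positivity) ?_ (by positivity)
        nlinarith [norm_nonneg x]
    _ = (1 + ‖x‖) ^ s := by
        rw [← Real.rpow_natCast, ← Real.rpow_mul (by positivity)]
        congr 1
        push_cast
        ring
    _ ≤ (1 + ‖x‖) ^ (⌈s⌉₊ : ℝ) :=
        Real.rpow_le_rpow_of_exponent_le (by linarith [norm_nonneg x]) (Nat.le_ceil s)
    _ = _ := Real.rpow_natCast _ _

/-- The coefficients of an absolutely convergent trigonometric series are bounded by the essential
supremum of its sum. -/
theorem enorm_coefficient_le_eLpNorm_top {φ : 𝓢(Rn n, ℂ)} (hφ : IsPeriodicPartition φ)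
    {d : (Fin n → ℤ) → ℂ} (hd : Summable fun β => ‖d β‖) {V : Rn n → ℂ}
    (hV : ∀ x, HasSum (fun β => d β *
      Complex.exp (((inner ℝ (latticePoint β) x : ℝ) : ℂ) * I)) (V x)) (α : Fin n → ℤ) :
    ‖d α * (((2 * π) ^ n : ℝ) : ℂ)‖ₑ ≤ (∫⁻ x, ‖φ x‖ₑ) * eLpNorm V ∞ volume := by
  -- Integration against `φ(x) e^{-iα·x}` plays the role of averaging over a period: by
  -- `character_partition` it kills every term but `β = α`.
  let F : (Fin n → ℤ) → Rn n → ℂ := fun β x => d β * (φ x *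
    Complex.exp (((inner ℝ (latticePoint (β - α)) x : ℝ) : ℂ) * I))
  have hFn : ∀ β x, ‖F β x‖ = ‖d β‖ * ‖φ x‖ := fun β x => by
    simp [F, Complex.norm_exp_ofReal_mul_I]
  have hFi : ∀ β, Integrable (F β) := fun β => by
    refine Integrable.const_mul ?_ _
    refine (φ.integrable (μ := volume)).mul_bdd (c := 1)
      (Continuous.aestronglyMeasurable (by fun_prop)) (Filter.Eventually.of_forall fun x => ?_)
    rw [Complex.norm_exp_ofReal_mul_I]
  have hI : ∀ β, ∫ x, F β x = d β * character (β - α) φ := fun β => by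
    rw [integral_const_mul, character_apply]
  have h1 := hasSum_integral_of_summable_integral_norm hFi (by
    simp only [hFn, integral_const_mul]
    exact hd.mul_right _)
  have h2 : ∀ x, ∑' β, F β x =
      φ x * (V x * Complex.exp (-(((inner ℝ (latticePoint α) x : ℝ) : ℂ) * I))) := fun x => by
    refine HasSum.tsum_eq ?_
    convert! ((hV x).mul_right (Complex.exp (-(((inner ℝ (latticePoint α) x : ℝ) : ℂ) * I)))
      ).mul_left (φ x) using 2 with β
    simp only [F]
    rw [mul_assoc (d β) (Complex.exp _), ← Complex.exp_add, latticePoint_sub, inner_sub_left]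
    rw [mul_left_comm]
    congr 4
    push_cast
    ring
  simp only [h2, hI, character_partition hφ] at h1
  have h3 := h1.unique (hasSum_single α fun β hβ => by simp [sub_eq_zero, hβ])
  simp only [sub_self, if_true] at h3
  rw [← h3]
  refine (enorm_integral_le_lintegral_enorm _).trans ?_
  rw [← lintegral_mul_const _ φ.continuous.measurable.enorm]
  refine lintegral_mono_ae ?_
  filter_upwards [ae_le_eLpNormEssSup (f := V) (μ := volume)] with x hx
  rw [enorm_mul, enorm_mul, eLpNorm_exponent_top]
  have h4 : ‖Complex.exp (-(((inner ℝ (latticePoint α) x : ℝ) : ℂ) * I))‖ₑ = 1 := by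
    rw [← ofReal_norm, norm_exp_neg_ofReal_mul_I, ENNReal.ofReal_one]
  rw [h4, mul_one]
  gcongr

/-- The inner norm in the definition of the modulation norm. -/
noncomputable def frequencySup (g : 𝓢(Rn n, ℂ)) (s : ℝ) (f : 𝓢'(Rn n, ℂ)) (ξ : Rn n) : ℝ≥0∞ :=
  eLpNorm (fun x : Rn n => stft g f x ξ * ((weight 0 x * weight s ξ : ℝ) : ℂ)) ∞ volume

theorem mem_modulationSpace_iff {g : 𝓢(Rn n, ℂ)} {q : ℝ≥0∞} (hq : q ≠ 0) (hq' : q ≠ ∞) {s : ℝ}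
    {f : 𝓢'(Rn n, ℂ)} :
    f ∈ modulationSpace g ∞ q s 0 ↔ ∫⁻ ξ, frequencySup g s f ξ ^ q.toReal < ∞ := by
  change eLpNorm (frequencySup g s f) q volume < ∞ ↔ _
  rw [eLpNorm_lt_top_iff_lintegral_rpow_enorm_lt_top hq hq']
  simp only [enorm_eq_self]

theorem mem_weightedSequenceSpace_iff {q : ℝ≥0∞} (hq : q ≠ 0) (hq' : q ≠ ∞) {s : ℝ}
    {c : (Fin n → ℤ) → ℂ} :
    c ∈ weightedSequenceSpace n q s ↔
      ∑' α, ENNReal.ofReal (weight s (latticePoint α) * ‖c α‖) ^ q.toReal < ∞ := by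
  have hq0 : 0 < q.toReal := ENNReal.toReal_pos hq hq'
  have h : ∀ α, ‖((weight s (latticePoint α) : ℝ) : ℂ) * c α‖ = weight s (latticePoint α) * ‖c α‖ :=
    fun α => by rw [norm_mul, Complex.norm_real, Real.norm_of_nonneg (weight_pos _ _).le]
  have hn : ∀ α, 0 ≤ weight s (latticePoint α) * ‖c α‖ :=
    fun α => mul_nonneg (weight_pos _ _).le (norm_nonneg _)
  change Memℓp _ q ↔ _
  rw [memℓp_gen_iff hq0]
  simp only [h, ENNReal.ofReal_rpow_of_nonneg (hn _) hq0.le]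
  refine ⟨fun hs => hs.tsum_ofReal_ne_top.lt_top, fun hs => ?_⟩
  refine (ENNReal.summable_toReal hs.ne).congr fun α => ?_
  rw [ENNReal.toReal_ofReal (Real.rpow_nonneg (hn α) _)]

theorem IsPeriodic.ofReal_coefficient_le_frequencySup {f : 𝓢'(Rn n, ℂ)} (hf : IsPeriodic f)
    {φ : 𝓢(Rn n, ℂ)} (hφ : IsPeriodicPartition φ) (g : 𝓢(Rn n, ℂ)) (s : ℝ) (ξ : Rn n)
    (α : Fin n → ℤ) :
    ENNReal.ofReal (stftConst n * (2 * π) ^ n * (‖fourierCoefficient φ f α‖ *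
        ‖windowTransform g (ξ - latticePoint α)‖ * weight s ξ)) ≤
      (∫⁻ x, ‖φ x‖ₑ) * frequencySup g s f ξ := by
  let d : (Fin n → ℤ) → ℂ := fun β => (stftConst n : ℂ) * (fourierCoefficient φ f β *
    windowTransform g (ξ - latticePoint β)) * (weight s ξ : ℂ)
  -- At `x = 0` the exponentials equal one, and unconditional summability in `ℂ` is absolute.
  have hd : Summable fun β => ‖d β‖ := by
    have h := ((hf.hasSum_stft hφ g 0 ξ).summable.mul_right (weight s ξ : ℂ)).norm
    simpa [d] using h
  -- The factor `e^{iξ·x}` shifts the frequencies onto the lattice without changing the modulus.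
  have hV : ∀ x, HasSum (fun β => d β *
      Complex.exp (((inner ℝ (latticePoint β) x : ℝ) : ℂ) * I))
      (stft g f x ξ * (weight s ξ : ℂ) * Complex.exp (((inner ℝ ξ x : ℝ) : ℂ) * I)) := fun x => by
    convert! ((hf.hasSum_stft hφ g x ξ).mul_right (weight s ξ : ℂ)).mul_right
      (Complex.exp (((inner ℝ ξ x : ℝ) : ℂ) * I)) using 2 with β
    have h1 : Complex.exp (((inner ℝ (latticePoint β) x : ℝ) : ℂ) * I) =
        Complex.exp (-(((inner ℝ (ξ - latticePoint β) x : ℝ) : ℂ) * I)) *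
          Complex.exp (((inner ℝ ξ x : ℝ) : ℂ) * I) := by
      rw [← Complex.exp_add, inner_sub_left]
      congr 1
      push_cast
      ring
    rw [h1]
    ring
  have h := enorm_coefficient_le_eLpNorm_top hφ hd hV α
  have h1 : eLpNorm (fun x => stft g f x ξ * (weight s ξ : ℂ) *
      Complex.exp (((inner ℝ ξ x : ℝ) : ℂ) * I)) ∞ volume = frequencySup g s f ξ := by
    refine eLpNorm_congr_norm_ae (Filter.Eventually.of_forall fun x => ?_)
    simp only [norm_mul, Complex.norm_exp_ofReal_mul_I, weight_zero, one_mul, mul_one]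
  rw [h1] at h
  refine le_of_eq_of_le ?_ h
  rw [← ofReal_norm]
  congr 1
  simp only [d, norm_mul, Complex.norm_real, Real.norm_of_nonneg stftConst_pos.le,
    Real.norm_of_nonneg (weight_pos s ξ).le]
  rw [Real.norm_of_nonneg (by positivity)]
  ring

end ShortTimeFourierTransform

/-! ### Two-sided comparison of the modulation norm with the weighted sequence norm. -/

section Characterization

variable {n : ℕ}

theorem exists_ball_windowTransform {g : 𝓢(Rn n, ℂ)} (hg : g ≠ 0) :
    ∃ (η : Rn n) (δ r : ℝ), 0 < δ ∧ 0 < r ∧ r < 1 / 2 ∧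
      ∀ y ∈ Metric.ball η r, δ ≤ ‖windowTransform g y‖ := by
  obtain ⟨η, hη⟩ := exists_windowTransform_ne_zero hg
  have hpos : 0 < ‖windowTransform g η‖ := norm_pos_iff.mpr hη
  have h := (continuous_windowTransform g).norm.continuousAt (x := η) |>.eventually_const_lt
    (half_lt_self hpos)
  obtain ⟨r, hr, hball⟩ := Metric.eventually_nhds_iff_ball.mp h
  -- Capping the radius at `1 / 3`, below `1 / 2`, makes the balls around distinct shifted lattice
  -- points disjoint.
  refine ⟨η, ‖windowTransform g η‖ / 2, min r (1 / 3), half_pos hpos, lt_min hr (by norm_num),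
    (min_le_right _ _).trans_lt (by norm_num), fun y hy => (hball y ?_).le⟩
  exact Metric.ball_subset_ball (min_le_left _ _) hy

theorem pairwise_disjoint_ball_latticePoint {η : Rn n} {r : ℝ} (hr : r < 1 / 2) :
    Pairwise (Function.onFun Disjoint fun α : Fin n → ℤ =>
      Metric.ball (latticePoint α + η) r) := by
  intro α β h
  refine Metric.ball_disjoint_ball ?_
  rw [dist_add_right, dist_eq_norm, ← latticePoint_sub]
  linarith [one_le_norm_latticePoint (sub_ne_zero.mpr h)]

/-- On the ball, `windowTransform g (ξ - α)` is at least `δ` in modulus and `ξ` stays within `‖η‖ +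
r` of `α`, so Peetre's inequality replaces the weight at `α` by the weight at `ξ`. -/
theorem IsPeriodic.exists_weighted_coefficient_le {f : 𝓢'(Rn n, ℂ)} (hf : IsPeriodic f)
    {φ : 𝓢(Rn n, ℂ)} (hφ : IsPeriodicPartition φ) {g : 𝓢(Rn n, ℂ)} {η : Rn n} {δ r : ℝ}
    (hδ : 0 < δ) (hball : ∀ y ∈ Metric.ball η r, δ ≤ ‖windowTransform g y‖)
    {s : ℝ} (hs : 0 ≤ s) :
    ∃ D : ℝ≥0∞, D ≠ ∞ ∧ ∀ α, ∀ ξ ∈ Metric.ball (latticePoint α + η) r,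
      ENNReal.ofReal (weight s (latticePoint α) * ‖fourierCoefficient φ f α‖) ≤
        D * frequencySup g s f ξ := by
  let κ : ℝ := stftConst n * (2 * π) ^ n
  have hκ : 0 < κ := mul_pos stftConst_pos (by positivity)
  let A : ℝ := 2 ^ (s / 2) * (1 + ‖η‖ + r) ^ ⌈s⌉₊ / (κ * δ)
  refine ⟨ENNReal.ofReal A * ∫⁻ x, ‖φ x‖ₑ,
    ENNReal.mul_ne_top ENNReal.ofReal_ne_top (φ.integrable (μ := volume)).2.ne, fun α ξ hξ => ?_⟩
  have hξ' : ξ - latticePoint α ∈ Metric.ball η r := by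
    rw [mem_ball_iff_norm] at hξ ⊢
    rwa [sub_sub]
  have hK := hball _ hξ'
  have hnorm : ‖latticePoint α - ξ‖ ≤ ‖η‖ + r := by
    rw [mem_ball_iff_norm] at hξ'
    rw [norm_sub_rev]
    have := norm_le_norm_add_norm_sub' (ξ - latticePoint α) η
    linarith
  have hw : weight s (latticePoint α) ≤
      2 ^ (s / 2) * (weight s ξ * (1 + ‖η‖ + r) ^ ⌈s⌉₊) := by
    refine (weight_le_mul hs (latticePoint α) ξ).trans ?_
    have h1 : weight s (latticePoint α - ξ) ≤ (1 + ‖η‖ + r) ^ ⌈s⌉₊ :=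
      (weight_le_one_add_norm_pow hs _).trans (pow_le_pow_left₀ (by positivity) (by linarith) _)
    have h2 := (weight_pos s ξ).le
    gcongr
  have hr0 : 0 ≤ 1 + ‖η‖ + r := by linarith [norm_nonneg (latticePoint α - ξ)]
  have hA : 0 ≤ A := by positivity
  rw [mul_assoc]
  refine le_trans ?_ (mul_le_mul_right (hf.ofReal_coefficient_le_frequencySup hφ g s ξ α) _)
  rw [← ENNReal.ofReal_mul hA]
  refine ENNReal.ofReal_le_ofReal ?_
  have hw0 := (weight_pos s ξ).le
  calc weight s (latticePoint α) * ‖fourierCoefficient φ f α‖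
      ≤ 2 ^ (s / 2) * (weight s ξ * (1 + ‖η‖ + r) ^ ⌈s⌉₊) * ‖fourierCoefficient φ f α‖ := by
        gcongr
    _ = A * (κ * (‖fourierCoefficient φ f α‖ * δ * weight s ξ)) := by
        simp only [A]
        field_simp
    _ ≤ A * (κ * (‖fourierCoefficient φ f α‖ * ‖windowTransform g (ξ - latticePoint α)‖ *
          weight s ξ)) := by gcongr

/-- The pointwise lower bound is integrated over disjoint balls of equal volume and summed over `α`.
-/
theorem IsPeriodic.mem_weightedSequenceSpace {f : 𝓢'(Rn n, ℂ)} (hf : IsPeriodic f)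
    {φ : 𝓢(Rn n, ℂ)} (hφ : IsPeriodicPartition φ) {g : 𝓢(Rn n, ℂ)} (hg : g ≠ 0)
    {s : ℝ} (hs : 0 ≤ s) {q : ℝ≥0∞} (hq : q ≠ 0) (hq' : q ≠ ∞)
    (h : f ∈ modulationSpace g ∞ q s 0) :
    fourierCoefficient φ f ∈ weightedSequenceSpace n q s := by
  rw [mem_modulationSpace_iff hq hq'] at h
  rw [mem_weightedSequenceSpace_iff hq hq']
  have hp : 0 ≤ q.toReal := ENNReal.toReal_nonneg
  obtain ⟨η, δ, r, hδ, hr, hr', hball⟩ := exists_ball_windowTransform hg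
  obtain ⟨D, hD, hle⟩ := hf.exists_weighted_coefficient_le hφ hδ hball hs
  set b : (Fin n → ℤ) → ℝ≥0∞ := fun α =>
    ENNReal.ofReal (weight s (latticePoint α) * ‖fourierCoefficient φ f α‖) ^ q.toReal with hb
  set B := volume (Metric.ball (0 : Rn n) r)
  have hB0 : B ≠ 0 := (Metric.measure_ball_pos volume _ hr).ne'
  have hDp : D ^ q.toReal ≠ ∞ := ENNReal.rpow_ne_top_of_nonneg hp hD
  have h1 : ∀ α, b α * B ≤ ∫⁻ ξ in Metric.ball (latticePoint α + η) r,
      D ^ q.toReal * frequencySup g s f ξ ^ q.toReal := fun α => by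
    have hBα : B = volume (Metric.ball (latticePoint α + η) r) :=
      (Measure.addHaar_ball_center volume _ r).symm
    rw [hBα, ← setLIntegral_const]
    refine setLIntegral_mono' measurableSet_ball fun ξ hξ => ?_
    rw [← ENNReal.mul_rpow_of_nonneg _ _ hp]
    exact ENNReal.rpow_le_rpow (hle α ξ hξ) hp
  have h2 : (∑' α, b α) * B ≤ D ^ q.toReal * ∫⁻ ξ, frequencySup g s f ξ ^ q.toReal := by
    rw [← ENNReal.tsum_mul_right, ← lintegral_const_mul' _ _ hDp]
    refine (ENNReal.tsum_le_tsum h1).trans ?_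
    rw [← lintegral_iUnion (fun _ => measurableSet_ball)
      (pairwise_disjoint_ball_latticePoint hr')]
    exact setLIntegral_le_lintegral _ _
  have h3 : (∑' α, b α) * B < ∞ := h2.trans_lt (ENNReal.mul_lt_top hDp.lt_top h)
  exact ENNReal.lt_top_of_mul_ne_top_left h3.ne hB0

/-- Jensen's inequality for weighted sums with values in `[0, ∞]`. -/
theorem tsum_mul_rpow_le {ι : Type*} {p : ℝ} (hp : 1 ≤ p) (w b : ι → ℝ≥0∞) :
    (∑' i, w i * b i) ^ p ≤ (∑' i, w i) ^ (p - 1) * ∑' i, w i * b i ^ p := by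
  have hp0 : 0 < p := by linarith
  -- Weighted Hölder on finite partial sums, followed by the supremum.
  have h : ∑' i, w i * b i ≤ (∑' i, w i) ^ (1 - p⁻¹) * (∑' i, w i * b i ^ p) ^ p⁻¹ := by
    rw [ENNReal.tsum_eq_iSup_sum]
    refine iSup_le fun t => (ENNReal.inner_le_weight_mul_Lp_of_nonneg t hp w b).trans ?_
    have h1 : 0 ≤ 1 - p⁻¹ := sub_nonneg.mpr (inv_le_one_of_one_le₀ hp)
    gcongr
    · exact ENNReal.sum_le_tsum t
    · exact ENNReal.sum_le_tsum t
  refine (ENNReal.rpow_le_rpow h hp0.le).trans_eq ?_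
  rw [ENNReal.mul_rpow_of_nonneg _ _ hp0.le, ← ENNReal.rpow_mul, ← ENNReal.rpow_mul,
    inv_mul_cancel₀ hp0.ne', ENNReal.rpow_one, sub_mul, one_mul, inv_mul_cancel₀ hp0.ne']

/-- The function `(1 + |η|)^{-(n+1)}` with values in `[0, ∞]`. -/
noncomputable def decayKernel (η : Rn n) : ℝ≥0∞ := ENNReal.ofReal ((1 + ‖η‖) ^ (n + 1))⁻¹

theorem measurable_decayKernel : Measurable (decayKernel (n := n)) := by
  unfold decayKernel
  fun_prop

theorem lintegral_decayKernel_lt_top : ∫⁻ η : Rn n, decayKernel η < ∞ := by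
  have h : Integrable fun η : Rn n => (1 + ‖η‖) ^ (-((n + 1 : ℕ) : ℝ)) :=
    integrable_one_add_norm (by simp)
  refine lt_of_eq_of_lt ?_ h.lintegral_lt_top
  refine lintegral_congr fun η => ?_
  rw [decayKernel, Real.rpow_neg (by positivity), Real.rpow_natCast]

theorem exists_norm_sub_latticePoint_le (ξ : Rn n) :
    ∃ k : Fin n → ℤ, ‖ξ - latticePoint k‖ ≤ √n := by
  refine ⟨fun j => ⌊ξ j⌋, ?_⟩
  rw [EuclideanSpace.norm_eq]
  refine Real.sqrt_le_sqrt ?_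
  calc _ ≤ ∑ _j : Fin n, (1 : ℝ) := by
        refine Finset.sum_le_sum fun j _ => ?_
        rw [PiLp.sub_apply, latticePoint_apply, Real.norm_eq_abs, sq_abs]
        have h1 := Int.floor_le (ξ j)
        have h2 := Int.lt_floor_add_one (ξ j)
        exact pow_le_one₀ (by linarith) (by linarith)
    _ = n := by simp

/-- Shifting the index by the coordinatewise floor of `ξ` reduces to `ξ` within `√n` of the origin,
where the sum is comparable to the one at zero. -/
theorem exists_tsum_decayKernel_le :
    ∃ M : ℝ≥0∞, M ≠ ∞ ∧ ∀ ξ : Rn n, ∑' α, decayKernel (ξ - latticePoint α) ≤ M := by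
  let S : ℝ≥0∞ := ∑' α : Fin n → ℤ, decayKernel (latticePoint α)
  have hS : S ≠ ∞ := summable_one_add_norm_latticePoint_inv.tsum_ofReal_ne_top
  refine ⟨ENNReal.ofReal ((1 + √n) ^ (n + 1)) * S, ENNReal.mul_ne_top ENNReal.ofReal_ne_top hS,
    fun ξ => ?_⟩
  obtain ⟨k, hk⟩ := exists_norm_sub_latticePoint_le ξ
  rw [← (Equiv.addLeft k).tsum_eq (fun α => decayKernel (ξ - latticePoint α)),
    ← ENNReal.tsum_mul_left]
  refine ENNReal.tsum_le_tsum fun α => ?_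
  rw [decayKernel, decayKernel, ← ENNReal.ofReal_mul (by positivity)]
  refine ENNReal.ofReal_le_ofReal ?_
  have h := one_add_norm_le_mul_one_add_norm_sub (latticePoint α) (ξ - latticePoint k)
  have h1 : 1 + ‖latticePoint α‖ ≤
      (1 + √n) * (1 + ‖ξ - latticePoint (Equiv.addLeft k α)‖) := by
    refine h.trans ?_
    rw [Equiv.coe_addLeft, latticePoint_add, sub_sub]
    gcongr
  rw [inv_eq_one_div, ← div_eq_mul_inv, div_le_div_iff₀ (by positivity) (by positivity), one_mul,
    ← mul_pow]
  gcongr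

theorem exists_weight_mul_windowTransform_le (g : 𝓢(Rn n, ℂ)) {s : ℝ} (hs : 0 ≤ s) :
    ∃ C : ℝ, 0 ≤ C ∧ ∀ η : Rn n,
      weight s η * ‖windowTransform g η‖ ≤ C * ((1 + ‖η‖) ^ (n + 1))⁻¹ := by
  obtain ⟨C, hC, h⟩ := exists_norm_comp_inv_two_pi_smul_le
    (FourierTransform.fourier
      (SchwartzMap.postcompCLM (𝕜 := ℝ) (Complex.conjCLE : ℂ →L[ℝ] ℂ) g)) (⌈s⌉₊ + (n + 1))
  refine ⟨C, hC, fun η => ?_⟩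
  calc weight s η * ‖windowTransform g η‖
      ≤ (1 + ‖η‖) ^ ⌈s⌉₊ * (C * ((1 + ‖η‖) ^ (⌈s⌉₊ + (n + 1)))⁻¹) :=
        mul_le_mul (weight_le_one_add_norm_pow hs η) (h η) (norm_nonneg _) (by positivity)
    _ = _ := by
        rw [pow_add]
        field_simp

/-- Triangle inequality in the series for the transform. Peetre's inequality splits the weight at
`ξ` between `α` and `ξ - α`; the second part is absorbed by the decay of `windowTransform g`. -/
theorem IsPeriodic.exists_frequencySup_le {f : 𝓢'(Rn n, ℂ)} (hf : IsPeriodic f)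
    {φ : 𝓢(Rn n, ℂ)} (hφ : IsPeriodicPartition φ) (g : 𝓢(Rn n, ℂ)) {s : ℝ} (hs : 0 ≤ s) :
    ∃ C : ℝ≥0∞, C ≠ ∞ ∧ ∀ ξ, frequencySup g s f ξ ≤ C * ∑' α, decayKernel (ξ - latticePoint α) *
      ENNReal.ofReal (weight s (latticePoint α) * ‖fourierCoefficient φ f α‖) := by
  obtain ⟨C, hC, hle⟩ := exists_weight_mul_windowTransform_le g hs
  have hκ := (stftConst_pos (n := n)).le
  let A : ℝ := stftConst n * 2 ^ (s / 2) * C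
  have hA : 0 ≤ A := by positivity
  refine ⟨ENNReal.ofReal A, ENNReal.ofReal_ne_top, fun ξ => ?_⟩
  rw [frequencySup, eLpNorm_exponent_top]
  refine eLpNormEssSup_le_of_ae_enorm_bound (Filter.Eventually.of_forall fun x => ?_)
  have h := (hf.hasSum_stft hφ g x ξ).mul_right ((weight 0 x * weight s ξ : ℝ) : ℂ)
  rw [← h.tsum_eq, ← ENNReal.tsum_mul_left]
  refine (enorm_tsum_le_tsum_enorm).trans (ENNReal.tsum_le_tsum fun α => ?_)
  rw [decayKernel, ← ENNReal.ofReal_mul (by positivity), ← ENNReal.ofReal_mul hA, ← ofReal_norm]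
  refine ENNReal.ofReal_le_ofReal ?_
  have hwξ := (weight_pos s ξ).le
  have hwα := (weight_pos s (latticePoint α)).le
  rw [norm_mul, norm_mul, norm_mul, norm_mul, norm_exp_neg_ofReal_mul_I, weight_zero,
    Complex.norm_real, Complex.norm_real, one_mul, mul_one, Real.norm_of_nonneg hκ,
    Real.norm_of_nonneg hwξ]
  calc stftConst n * (‖fourierCoefficient φ f α‖ * ‖windowTransform g (ξ - latticePoint α)‖) *
        weight s ξ
      ≤ stftConst n * (‖fourierCoefficient φ f α‖ * ‖windowTransform g (ξ - latticePoint α)‖) *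
        (2 ^ (s / 2) * (weight s (latticePoint α) * weight s (ξ - latticePoint α))) := by
        gcongr
        exact weight_le_mul hs _ _
    _ = stftConst n * 2 ^ (s / 2) * (weight s (latticePoint α) * ‖fourierCoefficient φ f α‖) *
        (weight s (ξ - latticePoint α) * ‖windowTransform g (ξ - latticePoint α)‖) := by ring
    _ ≤ stftConst n * 2 ^ (s / 2) * (weight s (latticePoint α) * ‖fourierCoefficient φ f α‖) *
        (C * ((1 + ‖ξ - latticePoint α‖) ^ (n + 1))⁻¹) := by
        exact mul_le_mul_of_nonneg_left (hle _) (by positivity)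
    _ = _ := by
        simp only [A]
        ring

/-- A Young-type inequality mixing sums and integrals: Jensen costs the uniform bound `M` on lattice
sums of the kernel to the power `q - 1`, and Tonelli leaves the integral of the kernel times the
`ℓ^q` sum. -/
theorem IsPeriodic.mem_modulationSpace {f : 𝓢'(Rn n, ℂ)} (hf : IsPeriodic f)
    {φ : 𝓢(Rn n, ℂ)} (hφ : IsPeriodicPartition φ) (g : 𝓢(Rn n, ℂ))
    {s : ℝ} (hs : 0 ≤ s) {q : ℝ≥0∞} (hq : 1 ≤ q) (hq' : q ≠ ∞)
    (h : fourierCoefficient φ f ∈ weightedSequenceSpace n q s) :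
    f ∈ modulationSpace g ∞ q s 0 := by
  have hq0 : q ≠ 0 := (zero_lt_one.trans_le hq).ne'
  rw [mem_weightedSequenceSpace_iff hq0 hq'] at h
  rw [mem_modulationSpace_iff hq0 hq']
  have hp1 : 1 ≤ q.toReal := by
    simpa using ENNReal.toReal_mono hq' hq
  have hp : 0 ≤ q.toReal := zero_le_one.trans hp1
  obtain ⟨C, hC, hle⟩ := hf.exists_frequencySup_le hφ g hs
  obtain ⟨M, hM, hMle⟩ := exists_tsum_decayKernel_le (n := n)
  set b : (Fin n → ℤ) → ℝ≥0∞ := fun α =>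
    ENNReal.ofReal (weight s (latticePoint α) * ‖fourierCoefficient φ f α‖)
  set A : ℝ≥0∞ := C ^ q.toReal * M ^ (q.toReal - 1) with hA
  have hA' : A ≠ ∞ := ENNReal.mul_ne_top (ENNReal.rpow_ne_top_of_nonneg hp hC)
    (ENNReal.rpow_ne_top_of_nonneg (by linarith) hM)
  have h1 : ∀ ξ, frequencySup g s f ξ ^ q.toReal ≤
      A * ∑' α, decayKernel (ξ - latticePoint α) * b α ^ q.toReal := fun ξ => by
    refine (ENNReal.rpow_le_rpow (hle ξ) hp).trans ?_
    rw [ENNReal.mul_rpow_of_nonneg _ _ hp, hA, mul_assoc]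
    gcongr
    refine (tsum_mul_rpow_le hp1 _ _).trans ?_
    refine mul_le_mul_left (ENNReal.rpow_le_rpow (hMle ξ) (by linarith)) _
  refine (lintegral_mono h1).trans_lt ?_
  have hm : ∀ α : Fin n → ℤ, Measurable fun ξ : Rn n => decayKernel (ξ - latticePoint α) :=
    fun α => measurable_decayKernel.comp (measurable_id.sub_const _)
  rw [lintegral_const_mul' _ _ hA', lintegral_tsum fun α => ((hm α).mul_const _).aemeasurable]
  refine ENNReal.mul_lt_top hA'.lt_top ?_
  simp only [lintegral_mul_const _ (hm _), lintegral_sub_right_eq_self (μ := volume) decayKernel]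
  rw [ENNReal.tsum_mul_left]
  exact ENNReal.mul_lt_top lintegral_decayKernel_lt_top h

end Characterization

end PeriodicModulation

theorem mainTheorem7 (n : ℕ) (q : ℝ≥0∞) (hq : 1 ≤ q) (hq' : q ≠ ∞) (s : ℝ) (hs : 1 < s)
    (φ : 𝓢(PeriodicModulation.Rn n, ℂ)) (hφ : PeriodicModulation.IsPeriodicPartition φ)
    (g : 𝓢(PeriodicModulation.Rn n, ℂ)) (hg : g ≠ 0)
    (f : 𝓢'(PeriodicModulation.Rn n, ℂ)) (hf : PeriodicModulation.IsPeriodic f) :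
    HasSum (fun α : Fin n → ℤ =>
        PeriodicModulation.fourierCoefficient φ f α • PeriodicModulation.character α) f ∧
      (f ∈ PeriodicModulation.modulationSpace g ∞ q s 0 ↔
        PeriodicModulation.fourierCoefficient φ f ∈
          PeriodicModulation.weightedSequenceSpace n q s) :=
  have hs0 : 0 ≤ s := by linarith
  ⟨hf.hasSum_fourierCoefficient_smul_character hφ,
    hf.mem_weightedSequenceSpace hφ hg hs0 (zero_lt_one.trans_le hq).ne' hq',
    hf.mem_modulationSpace hφ g hs0 hq hq'⟩
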